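/- Let $s\in(0,1)$ and $p\in(1,\infty)$ with $sp>1$, and let $\delta>0$. Let $\gamma:\mathbb R/\mathbb Z\to\mathbb R^2\equiv\mathbb C$ be a Lipschitz closed curve of constant speed, that is, there is $C>0$ with $|\dot\gamma(t)|=C$ for almost every $t$. Put $\tau=\dot\gamma/|\dot\gamma|$, let $\ell(\gamma)$ be the length of $\gamma$, and let $$G_\delta(\gamma)=\ell(\gamma)+\delta\int_{\mathbb R/\mathbb Z}\int_{\mathbb R/\mathbb Z}\frac{|\tau(t)-\tau(t')|^p}{|\gamma(t)-\gamma(t')|^{1+sp}}\,|\dot\gamma(t)|\,|\dot\gamma(t')|\,dt\,dt'\in[0,\infty].$$ (i) Suppose that for every $x\notin\gamma(\mathbb R/\mathbb Z)$ the winding number $$\omega(\gamma,x)=\frac1{2\pi i}\int_{\mathbb R/\mathbb Z}\frac{\dot\gamma(t)}{\gamma(t)-x}\,dt$$ is $0$ or $1$. If $G_\delta(\gamma)<\infty$, then $\gamma\in W^{1+s,p}(\mathbb R/\mathbb Z,\mathbb R^2)$, that is, $\gamma\in L^p$ and $\gamma$ has a weak derivative $v\in L^p$ with $\iint |v(t)-v(t')|^p\,|t-t'|^{-1-sp}\,dt\,dt'<\infty$,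 where $|t-t'|$ is the distance on $\mathbb R/\mathbb Z$; moreover $\gamma$ is embedded, that is, $\gamma$ is of class $C^1$ with $\dot\gamma\neq0$ everywhere, injective, and bi-Lipschitz: there are $m>0$ and $L$ with $m|t-t'|\le|\gamma(t)-\gamma(t')|\le L|t-t'|$ for all $t,t'\in\mathbb R/\mathbb Z$. (ii) If there are $t_1\neq t_2$ in $\mathbb R/\mathbb Z$ with $\gamma(t_1)=\gamma(t_2)$ at which $\gamma$ is differentiable with $\dot\gamma(t_1)\neq\dot\gamma(t_2)$, then $G_\delta(\gamma)=\infty$ (whatever the winding numbers of $\gamma$ are). -/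

import Mathlib

open MeasureTheory
open scoped ContDiff

noncomputable section

/-- Derivative at `t` of a function on the circle `ℝ/ℤ` (that is, of its `1`-periodic lift). -/
def circleDeriv {F : Type*} [NormedAddCommGroup F] [NormedSpace ℝ F]
    (u : UnitAddCircle → F) (t : UnitAddCircle) : F :=
  deriv (fun h : ℝ => u (t + (h : UnitAddCircle))) 0

/-- `u` is differentiable at the point `t` of `ℝ/ℤ`, with derivative `d`. -/
def HasCircleDerivAt {F : Type*} [NormedAddCommGroup F] [NormedSpace ℝ F]
    (u : UnitAddCircle → F) (d : F) (t : UnitAddCircle) : Prop :=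
  HasDerivAt (fun h : ℝ => u (t + (h : UnitAddCircle))) d 0

/-- `u` is of class `C^n` on `ℝ/ℤ`. -/
def CircleContDiff {F : Type*} [NormedAddCommGroup F] [NormedSpace ℝ F]
    (n : WithTop ℕ∞) (u : UnitAddCircle → F) : Prop :=
  ContDiff ℝ n (fun x : ℝ => u (x : UnitAddCircle))

/-! Plane curves `ℝ/ℤ → ℝ² ≡ ℂ`. The measure on `ℝ/ℤ` is Lebesgue measure of total mass `1`, and
the norm of `t - t'` in `ℝ/ℤ` is the distance on the circle. -/

/-- The speed `|γ'|` equals almost everywhere one positive constant. -/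
def HasConstantSpeed (γ : UnitAddCircle → ℂ) : Prop :=
  ∃ C : ℝ, 0 < C ∧ ∀ᵐ t : UnitAddCircle, ‖circleDeriv γ t‖ = C

/-- The length: the supremum of the lengths of inscribed polygons. -/
def curveLength (γ : UnitAddCircle → ℂ) : ENNReal :=
  eVariationOn (fun x : ℝ => γ (x : UnitAddCircle)) (Set.Icc 0 1)

/-- The unit tangent `τ = γ' / |γ'|`. -/
def unitTangent (γ : UnitAddCircle → ℂ) (t : UnitAddCircle) : ℂ :=
  (‖circleDeriv γ t‖⁻¹ : ℝ) • circleDeriv γ t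

/-- The winding number `(2πi)⁻¹ ∫ γ'(t) / (γ(t) - x) dt` (for `x` off the curve). -/
def windingNumber (γ : UnitAddCircle → ℂ) (x : ℂ) : ℂ :=
  (2 * Real.pi * Complex.I)⁻¹ * ∫ t : UnitAddCircle, circleDeriv γ t / (γ t - x)

/-- The nonlocal tangent energy
`∬ |τ(t) - τ(t')|^p / |γ(t) - γ(t')|^(1+sp) |γ'(t)| |γ'(t')| dt dt'`, with values in `[0,∞]`. -/
def tangentEnergy (s p : ℝ) (γ : UnitAddCircle → ℂ) : ENNReal :=
  ∫⁻ t : UnitAddCircle, ∫⁻ t' : UnitAddCircle,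
    ‖unitTangent γ t - unitTangent γ t'‖ₑ ^ p / ‖γ t - γ t'‖ₑ ^ (1 + s * p)
      * ‖circleDeriv γ t‖ₑ * ‖circleDeriv γ t'‖ₑ

/-- The functional `G_δ`: the length plus `δ` times the nonlocal tangent energy. -/
def energyG (s p δ : ℝ) (γ : UnitAddCircle → ℂ) : ENNReal :=
  curveLength γ + ENNReal.ofReal δ * tangentEnergy s p γ

/-- `v` is the weak derivative of `u` on `ℝ/ℤ`. -/
def IsWeakCircleDeriv (u v : UnitAddCircle → ℂ) : Prop :=
  ∀ φ : UnitAddCircle → ℝ, CircleContDiff ∞ φ →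
    ∫ t : UnitAddCircle, circleDeriv φ t • u t = -∫ t : UnitAddCircle, φ t • v t

/-- The fractional Sobolev space `W^{1+s,p}(ℝ/ℤ, ℝ²)`: `u` lies in `L^p` and has a weak derivative
`v` in `L^p` with finite Gagliardo seminorm `∬ |v(t) - v(t')|^p / |t - t'|^(1+sp) dt dt'`. -/
def MemFracSobolev (s p : ℝ) (u : UnitAddCircle → ℂ) : Prop :=
  MemLp u (ENNReal.ofReal p) volume ∧
  ∃ v : UnitAddCircle → ℂ, MemLp v (ENNReal.ofReal p) volume ∧ IsWeakCircleDeriv u v ∧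
    ∫⁻ t : UnitAddCircle, ∫⁻ t' : UnitAddCircle,
      ‖v t - v t'‖ₑ ^ p / ‖t - t'‖ₑ ^ (1 + s * p) < ⊤

/-- `γ` is embedded: a `C^1` immersion of `ℝ/ℤ` that is injective and bi-Lipschitz. -/
structure IsEmbeddedCurve (γ : UnitAddCircle → ℂ) : Prop where
  contDiff : CircleContDiff 1 γ
  regular : ∀ t, circleDeriv γ t ≠ 0
  injective : Function.Injective γ
  biLipschitz : ∃ m L : ℝ, 0 < m ∧
    ∀ t t' : UnitAddCircle, m * ‖t - t'‖ ≤ ‖γ t - γ t'‖ ∧ ‖γ t - γ t'‖ ≤ L * ‖t - t'‖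

end

open Set Filter Topology

/-! Suppose the energy is finite and γ(a) = γ(b). For y, z within r of a, b the chord |γ(y) - γ(z)|
is at most 2Kr, so the double integral of |γ'(y) - γ'(z)|^p over that square is O(r^(1+sp))
(`lintegral_square_enorm_deriv_sub_rpow_le`). For a = b this is a Campanato estimate; as sp > 1,
dyadic difference quotients converge uniformly and γ is C^1. For general a, b the mean over the
square is O(r^(sp-1)), which tends to 0 and forces γ'(a) = γ'(b) (`deriv_eq_of_tangentEnergy`). This
is (ii).

For (i), suppose a point c is hit twice, necessarily with one common velocity d. With w = (γ - c)/d,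
the jump of the winding number from c - iεd to c + iεd is π⁻¹∫ w'ε/(w² + ε²). Near each zero of w
the integrand is almost a Poisson kernel of mass π, and elsewhere its real part is at least -O(ε).
Two zeros thus push the jump above 1, impossible for values in {0, 1}. Injectivity, linearization
near the diagonal and compactness away from it give the bi-Lipschitz bound. The Sobolev seminorm is
dominated by the energy since γ is Lipschitz. -/

/-! ### Campanato estimates and C^1 regularity on the line -/

theorem LipschitzWith.intervalIntegrable_deriv {f : ℝ → ℂ} {K : NNReal}
    (hf : LipschitzWith K f) (a b : ℝ) : IntervalIntegrable (deriv f) volume a b := by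
  refine (intervalIntegrable_const (c := (K : ℝ))).mono_fun'
    (stronglyMeasurable_deriv f).aestronglyMeasurable ?_
  exact Eventually.of_forall fun x => norm_deriv_le_of_lipschitz hf

/-- The fundamental theorem of calculus for Lipschitz curves in the plane. -/
theorem LipschitzWith.integral_deriv_eq_sub {f : ℝ → ℂ} {K : NNReal}
    (hf : LipschitzWith K f) (a b : ℝ) : ∫ x in a..b, deriv f x = f b - f a := by
  have hint := hf.intervalIntegrable_deriv a b
  have hd : ∀ᵐ x : ℝ, DifferentiableAt ℝ f x := hf.ae_differentiableAt
  have key : ∀ (φ : ℂ →L[ℝ] ℝ), φ (∫ x in a..b, deriv f x) = φ (f b - f a) := by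
    intro φ
    have hφ : LipschitzWith (‖φ‖₊ * K) (fun x => φ (f x)) := φ.lipschitz.comp hf
    have h1 := (hφ.lipschitzOnWith
      (s := uIcc a b)).absolutelyContinuousOnInterval.integral_deriv_eq_sub
    rw [map_sub, ← h1, ← φ.intervalIntegral_comp_comm hint]
    refine intervalIntegral.integral_congr_ae ?_
    filter_upwards [hd] with x hx _
    exact ((φ.hasFDerivAt.comp_hasDerivAt x hx.hasDerivAt).deriv).symm
  exact Complex.ext (key Complex.reCLM) (key Complex.imCLM)

/-- The mean of `‖c - g‖` over an interval dominates the distance from `c` to the mean of `g`. -/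
theorem ofReal_mul_enorm_sub_average_le {g : ℝ → ℂ} {a r : ℝ} (hr : 0 < r)
    (hg : IntervalIntegrable g volume a (a + r)) (c : ℂ) :
    ENNReal.ofReal r * ‖c - (r⁻¹ : ℝ) • ∫ x in a..(a + r), g x‖ₑ
      ≤ ∫⁻ x in Ioc a (a + r), ‖c - g x‖ₑ := by
  have h1 : ENNReal.ofReal r * ‖c - (r⁻¹ : ℝ) • ∫ x in a..(a + r), g x‖ₑ
      = ‖∫ x in Ioc a (a + r), (c - g x)‖ₑ := by
    rw [← intervalIntegral.integral_of_le (by linarith),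
      intervalIntegral.integral_sub intervalIntegrable_const hg, intervalIntegral.integral_const,
      show ENNReal.ofReal r = ‖r‖ₑ from (Real.enorm_of_nonneg hr.le).symm, ← enorm_smul,
      smul_sub, smul_smul, mul_inv_cancel₀ hr.ne', one_smul, add_sub_cancel_left]
  rw [h1]
  exact enorm_integral_le_lintegral_enorm _

/-- Either a ≤ λ, or a^(p-1) ≥ λ^(p-1). This stands in for Hölder's inequality when an L^1
oscillation is bounded by an L^p one; λ is optimized at the point of use. -/
theorem ENNReal.le_add_rpow_mul_rpow {p lam : ℝ} (hp : 1 < p) (hlam : 0 < lam) (a : ENNReal) :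
    a ≤ ENNReal.ofReal lam + ENNReal.ofReal (lam ^ (1 - p)) * a ^ p := by
  rcases le_total a (ENNReal.ofReal lam) with h | h
  · exact h.trans le_self_add
  · refine le_trans ?_ le_add_self
    rcases eq_or_ne a ⊤ with rfl | ha
    · rw [ENNReal.top_rpow_of_pos (by linarith), ENNReal.mul_top]
      · simpa using Real.rpow_pos_of_pos hlam _
    have ha0 : a ≠ 0 := (lt_of_lt_of_le (ENNReal.ofReal_pos.2 hlam) h).ne'
    have h3 : ENNReal.ofReal lam ^ (p - 1) ≤ a ^ (p - 1) := ENNReal.rpow_le_rpow h (by linarith)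
    calc a = 1 * a := (one_mul a).symm
      _ = ENNReal.ofReal (lam ^ (1 - p)) * ENNReal.ofReal lam ^ (p - 1) * a := by
        rw [ENNReal.ofReal_rpow_of_pos hlam, ← ENNReal.ofReal_mul (by positivity),
          ← Real.rpow_add hlam]
        simp
      _ ≤ ENNReal.ofReal (lam ^ (1 - p)) * a ^ (p - 1) * a := by gcongr
      _ = _ := by
        rw [mul_assoc]
        congr 1
        nth_rewrite 2 [← ENNReal.rpow_one a]
        rw [← ENNReal.rpow_add _ _ ha0 ha]
        simp

/-- The difference quotient of step `r`. -/
noncomputable def diffQuot (f : ℝ → ℂ) (r x : ℝ) : ℂ := (r⁻¹ : ℝ) • (f (x + r) - f x)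

/-- Both quotients are means of f', over an interval and over its left half, so their gap is
controlled by the mean oscillation of f'. The p-th power mean is at most M r^(q-1), whence the
exponent (q-1)/p. -/
theorem norm_diffQuot_sub_half_le {f : ℝ → ℂ} {K : NNReal} (hf : LipschitzWith K f)
    {p q M r x : ℝ} (hp : 1 < p) (hM : 0 ≤ M) (hr : 0 < r)
    (h : ∫⁻ y in Ioc x (x + r), ∫⁻ z in Ioc x (x + r), ‖deriv f y - deriv f z‖ₑ ^ p
      ≤ ENNReal.ofReal (M * r ^ (1 + q))) :
    ‖diffQuot f r x - diffQuot f (r / 2) x‖ ≤ 2 * (1 + M) * r ^ ((q - 1) / p) := by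
  set α := (q - 1) / p with hα
  set g := deriv f
  have hA : diffQuot f r x = (r⁻¹ : ℝ) • ∫ y in x..(x + r), g y := by
    rw [hf.integral_deriv_eq_sub]; rfl
  have hB : diffQuot f (r / 2) x = ((r / 2)⁻¹ : ℝ) • ∫ y in x..(x + r / 2), g y := by
    rw [hf.integral_deriv_eq_sub]; rfl
  set A := diffQuot f r x
  set B := diffQuot f (r / 2) x
  -- This choice balances the two terms: λ^(1-p) r^(1+q) = r²λ, see `h6`.
  set lam := r ^ α with hlam_def
  have hlam : 0 < lam := Real.rpow_pos_of_pos hr _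
  have h1 : ENNReal.ofReal (r / 2) * ‖A - B‖ₑ ≤ ∫⁻ y in Ioc x (x + r), ‖A - g y‖ₑ := by
    rw [hB]
    refine (ofReal_mul_enorm_sub_average_le (half_pos hr) (hf.intervalIntegrable_deriv _ _) A).trans
      (lintegral_mono_set (Ioc_subset_Ioc_right (by linarith)))
  have h2 : ∀ y, ENNReal.ofReal r * ‖A - g y‖ₑ
      ≤ ENNReal.ofReal (r * lam) + ENNReal.ofReal (lam ^ (1 - p)) *
        ∫⁻ z in Ioc x (x + r), ‖g y - g z‖ₑ ^ p := by
    intro y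
    rw [← enorm_neg, neg_sub, hA]
    refine (ofReal_mul_enorm_sub_average_le hr (hf.intervalIntegrable_deriv _ _) (g y)).trans ?_
    refine (lintegral_mono fun z => ENNReal.le_add_rpow_mul_rpow hp hlam _).trans ?_
    rw [lintegral_add_left measurable_const, lintegral_const_mul' _ _ ENNReal.ofReal_ne_top]
    gcongr
    simp [ENNReal.ofReal_mul hr.le, mul_comm]
  have h3 : ENNReal.ofReal r * ∫⁻ y in Ioc x (x + r), ‖A - g y‖ₑ
      ≤ ENNReal.ofReal (r * r * lam + lam ^ (1 - p) * (M * r ^ (1 + q))) := by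
    rw [← lintegral_const_mul' _ _ ENNReal.ofReal_ne_top]
    refine (lintegral_mono h2).trans ?_
    rw [lintegral_add_left measurable_const, lintegral_const_mul' _ _ ENNReal.ofReal_ne_top,
      ENNReal.ofReal_add (by positivity) (by positivity)]
    refine add_le_add ?_ ?_
    · simp only [lintegral_const, MeasurableSet.univ, Measure.restrict_apply, univ_inter,
        Real.volume_Ioc, add_sub_cancel_left]
      rw [← ENNReal.ofReal_mul (by positivity)]
      exact ENNReal.ofReal_le_ofReal (by nlinarith)
    · rw [ENNReal.ofReal_mul (by positivity)]
      gcongr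
  have h4 : ENNReal.ofReal (r * (r / 2) * ‖A - B‖)
      ≤ ENNReal.ofReal (r * r * lam + lam ^ (1 - p) * (M * r ^ (1 + q))) := by
    refine le_trans (le_of_eq ?_) ((mul_le_mul_right h1 (ENNReal.ofReal r)).trans h3)
    rw [mul_assoc, ENNReal.ofReal_mul hr.le, ENNReal.ofReal_mul (by positivity), ofReal_norm]
  have h5 := (ENNReal.ofReal_le_ofReal_iff (by positivity)).1 h4
  have h6 : lam ^ (1 - p) * r ^ (1 + q) = r * r * lam := by
    rw [hlam_def, ← Real.rpow_mul hr.le, ← Real.rpow_add hr]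
    have : α * (1 - p) + (1 + q) = 1 + 1 + α := by
      rw [hα]; field_simp; ring
    rw [this, Real.rpow_add hr, Real.rpow_add hr, Real.rpow_one]
  have h7 : r * (r / 2) * ‖A - B‖ ≤ r * (r / 2) * (2 * (1 + M) * lam) := by
    refine h5.trans (le_of_eq ?_)
    rw [show lam ^ (1 - p) * (M * r ^ (1 + q)) = M * (lam ^ (1 - p) * r ^ (1 + q)) by ring, h6]
    ring
  exact le_of_mul_le_mul_left h7 (by positivity)

/-- One-dimensional fractional Sobolev embedding: a Lipschitz curve whose derivative satisfies a
Campanato type estimate with exponent `q > 1` is of class `C^1`. -/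
theorem exists_continuous_hasDerivAt_of_campanato {f : ℝ → ℂ} {K : NNReal} (hf : LipschitzWith K f)
    {p q M : ℝ} (hp : 1 < p) (hq : 1 < q) (hM : 0 ≤ M)
    (h : ∀ x r : ℝ, 0 < r → r ≤ 1 →
      ∫⁻ y in Ioc x (x + r), ∫⁻ z in Ioc x (x + r), ‖deriv f y - deriv f z‖ₑ ^ p
        ≤ ENNReal.ofReal (M * r ^ (1 + q))) :
    ∃ G : ℝ → ℂ, Continuous G ∧ ∀ x, HasDerivAt f (G x) x := by
  set α := (q - 1) / p with hα
  have hα0 : 0 < α := div_pos (by linarith) (by linarith)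
  set F : ℕ → ℝ → ℂ := fun n x => diffQuot f ((1 / 2 : ℝ) ^ n) x with hF
  -- The ratio of the geometric series bounding the dyadic steps; it is below 1 because q > 1.
  set θ : ℝ := (1 / 2 : ℝ) ^ α with hθ
  have hθ1 : θ < 1 := Real.rpow_lt_one (by norm_num) (by norm_num) hα0
  have hstep : ∀ x n, dist (F n x) (F (n + 1) x) ≤ 2 * (1 + M) * θ ^ n := by
    intro x n
    have hr : (0 : ℝ) < (1 / 2 : ℝ) ^ n := by positivity
    have := norm_diffQuot_sub_half_le hf hp hM hr
      (h x _ hr (pow_le_one₀ (by norm_num) (by norm_num)))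
    rw [dist_eq_norm, hF]
    simp only
    rw [pow_succ, show ((1 / 2 : ℝ) ^ n * (1 / 2)) = (1 / 2 : ℝ) ^ n / 2 by ring]
    refine this.trans (le_of_eq ?_)
    rw [hθ, ← Real.rpow_natCast (1 / 2 : ℝ) n, ← Real.rpow_natCast ((1 / 2 : ℝ) ^ α) n,
      ← Real.rpow_mul (by norm_num), ← Real.rpow_mul (by norm_num), mul_comm α]
  have hlim : ∀ x, ∃ y, Tendsto (fun n => F n x) atTop (𝓝 y) := fun x =>
    cauchySeq_tendsto_of_complete (cauchySeq_of_le_geometric θ _ hθ1 (hstep x))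
  choose G hG using hlim
  have hunif : TendstoUniformly F G atTop := by
    rw [Metric.tendstoUniformly_iff]
    intro ε hε
    have h0 : Tendsto (fun n => 2 * (1 + M) * θ ^ n / (1 - θ)) atTop (𝓝 0) := by
      have := ((tendsto_pow_atTop_nhds_zero_of_lt_one (by positivity) hθ1).const_mul
        (2 * (1 + M))).div_const (1 - θ)
      simpa using this
    filter_upwards [h0.eventually (gt_mem_nhds hε)] with n hn x
    rw [dist_comm]
    exact (dist_le_of_le_geometric_of_tendsto θ _ hθ1 (hstep x) (hG x) n).trans_lt hn
  have hFc : ∀ n, Continuous (F n) := by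
    intro n
    have := hf.continuous
    simp only [hF, diffQuot]
    fun_prop
  have hGc : Continuous G := hunif.continuous (Frequently.of_forall hFc)
  -- At points of differentiability the dyadic quotients converge to f'. So f is a primitive of the
  -- continuous G, and f' = G everywhere.
  have hae : ∀ᵐ x : ℝ, deriv f x = G x := by
    filter_upwards [hf.ae_differentiableAt] with x hx
    refine tendsto_nhds_unique ?_ (hG x)
    have h1 := hx.hasDerivAt.tendsto_slope_zero
    have h2 : Tendsto (fun n : ℕ => (1 / 2 : ℝ) ^ n) atTop (𝓝[≠] 0) :=
      tendsto_nhdsWithin_iff.2 ⟨tendsto_pow_atTop_nhds_zero_of_lt_one (by norm_num) (by norm_num),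
        Eventually.of_forall fun n => by simp⟩
    exact h1.comp h2
  refine ⟨G, hGc, fun x => ?_⟩
  have hfe : ∀ b, f b = f 0 + ∫ y in (0 : ℝ)..b, G y := by
    intro b
    have : ∫ y in (0 : ℝ)..b, G y = ∫ y in (0 : ℝ)..b, deriv f y := by
      refine intervalIntegral.integral_congr_ae ?_
      filter_upwards [hae] with y hy _ using hy.symm
    rw [this, hf.integral_deriv_eq_sub]
    ring
  rw [funext hfe]
  exact (intervalIntegral.integral_hasDerivAt_right (hGc.intervalIntegrable _ _)
    (hGc.stronglyMeasurableAtFilter _ _) hGc.continuousAt).const_add _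

/-! ### Lifts to the line and consequences of finite tangent energy -/

theorem circleDeriv_coe {F : Type*} [NormedAddCommGroup F] [NormedSpace ℝ F]
    (u : UnitAddCircle → F) (x : ℝ) :
    circleDeriv u (x : UnitAddCircle) = deriv (fun y : ℝ => u (y : UnitAddCircle)) x := by
  have := deriv_comp_const_add (fun y : ℝ => u (y : UnitAddCircle)) x 0
  simpa [circleDeriv, AddCircle.coe_add] using this

theorem UnitAddCircle.norm_coe_le (x : ℝ) : ‖(x : UnitAddCircle)‖ ≤ |x| := by
  rw [UnitAddCircle.norm_eq]
  simpa using round_le x 0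

theorem UnitAddCircle.lipschitzWith_coe : LipschitzWith 1 ((↑) : ℝ → UnitAddCircle) :=
  LipschitzWith.of_dist_le_mul fun x y => by
    rw [dist_eq_norm, ← AddCircle.coe_sub, NNReal.coe_one, one_mul, Real.dist_eq]
    exact UnitAddCircle.norm_coe_le _

theorem lipschitzWith_lift {γ : UnitAddCircle → ℂ} {K : NNReal} (hγ : LipschitzWith K γ) :
    LipschitzWith K (fun x : ℝ => γ (x : UnitAddCircle)) := by
  simpa [Function.comp_def] using hγ.comp UnitAddCircle.lipschitzWith_coe

/-- The integrand of the tangent energy controls the increments of the derivative. -/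
theorem enorm_circleDeriv_sub_rpow_le {γ : UnitAddCircle → ℂ} {C p q : ℝ} (hC : 0 < C) (hp : 0 < p)
    (hq : 0 ≤ q) {t t' : UnitAddCircle} (ht : ‖circleDeriv γ t‖ = C) (ht' : ‖circleDeriv γ t'‖ = C)
    {R : ENNReal} (hR0 : R ≠ 0) (hR : R ≠ ⊤) (h : ‖γ t - γ t'‖ₑ ≤ R) :
    ‖circleDeriv γ t - circleDeriv γ t'‖ₑ ^ p ≤ ENNReal.ofReal (C ^ (p - 2)) * R ^ q *
      (‖unitTangent γ t - unitTangent γ t'‖ₑ ^ p / ‖γ t - γ t'‖ₑ ^ q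
        * ‖circleDeriv γ t‖ₑ * ‖circleDeriv γ t'‖ₑ) := by
  have e1 : ‖circleDeriv γ t‖ₑ = ENNReal.ofReal C := by rw [← ofReal_norm, ht]
  have e2 : ‖circleDeriv γ t'‖ₑ = ENNReal.ofReal C := by rw [← ofReal_norm, ht']
  have e3 : ‖unitTangent γ t - unitTangent γ t'‖ₑ ^ p
      = ENNReal.ofReal (C ^ (-p)) * ‖circleDeriv γ t - circleDeriv γ t'‖ₑ ^ p := by
    rw [unitTangent, unitTangent, ht, ht', ← smul_sub, enorm_smul,
      ENNReal.mul_rpow_of_nonneg _ _ hp.le, Real.enorm_of_nonneg (by positivity),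
      ENNReal.ofReal_rpow_of_pos (by positivity), Real.inv_rpow hC.le, Real.rpow_neg hC.le]
  set D := ‖circleDeriv γ t - circleDeriv γ t'‖ₑ ^ p
  have hRq0 : R ^ q ≠ 0 := by simp [hR0, hR]
  have hRq : R ^ q ≠ ⊤ := ENNReal.rpow_ne_top_of_nonneg hq hR
  -- The weight C^(p-2) undoes the C^(-p) from normalizing the tangents and the two speed factors C.
  have hc : ENNReal.ofReal (C ^ (p - 2)) * ENNReal.ofReal (C ^ (-p)) * ENNReal.ofReal C
      * ENNReal.ofReal C = 1 := by
    rw [← ENNReal.ofReal_mul (by positivity), ← ENNReal.ofReal_mul (by positivity),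
      ← ENNReal.ofReal_mul (by positivity), ← Real.rpow_add hC, ← Real.rpow_add_one hC.ne',
      ← Real.rpow_add_one hC.ne', show p - 2 + -p + 1 + 1 = 0 by ring]
    simp
  rw [e1, e2, e3]
  calc D = (ENNReal.ofReal (C ^ (p - 2)) * ENNReal.ofReal (C ^ (-p)) * ENNReal.ofReal C
      * ENNReal.ofReal C) * (R ^ q * (R ^ q)⁻¹) * D := by
        rw [hc, ENNReal.mul_inv_cancel hRq0 hRq, one_mul, one_mul]
    _ ≤ (ENNReal.ofReal (C ^ (p - 2)) * ENNReal.ofReal (C ^ (-p)) * ENNReal.ofReal C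
      * ENNReal.ofReal C) * (R ^ q * (‖γ t - γ t'‖ₑ ^ q)⁻¹) * D := by
        gcongr
    _ = _ := by rw [ENNReal.div_eq_inv_mul]; ring

theorem ae_norm_deriv_lift {γ : UnitAddCircle → ℂ} {C : ℝ}
    (hC : ∀ᵐ t : UnitAddCircle, ‖circleDeriv γ t‖ = C) (a : ℝ) {r : ℝ} (hr : r ≤ 1) :
    ∀ᵐ y : ℝ ∂volume.restrict (Ioc a (a + r)), ‖circleDeriv γ (y : UnitAddCircle)‖ = C := by
  have h1 : ∀ᵐ y : ℝ ∂volume.restrict (Ioc a (a + 1)), ‖circleDeriv γ (y : UnitAddCircle)‖ = C :=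
    (UnitAddCircle.measurePreserving_mk a).quasiMeasurePreserving.tendsto_ae hC
  exact ae_mono (Measure.restrict_mono (Ioc_subset_Ioc_right (by linarith)) le_rfl) h1

theorem setLIntegral_lift_le (F : UnitAddCircle → ENNReal) (a : ℝ) {r : ℝ} (hr : r ≤ 1) :
    ∫⁻ y in Ioc a (a + r), F y ≤ ∫⁻ t, F t := by
  rw [← UnitAddCircle.lintegral_preimage a]
  exact lintegral_mono_set (Ioc_subset_Ioc_right (by linarith))

/-- Near a pair of parameters with the same image, finite tangent energy controls the increments of
the derivative on squares. -/
theorem lintegral_square_enorm_deriv_sub_rpow_le {γ : UnitAddCircle → ℂ} {K : NNReal}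
    (hγ : LipschitzWith K γ) (hK : 0 < K) {C s p : ℝ} (hC : 0 < C)
    (hspeed : ∀ᵐ t : UnitAddCircle, ‖circleDeriv γ t‖ = C) (hp : 0 < p) (hsp : 0 ≤ 1 + s * p)
    (hE : tangentEnergy s p γ ≠ ⊤) {a b r : ℝ} (hr : 0 < r) (hr1 : r ≤ 1)
    (hab : γ (a : UnitAddCircle) = γ (b : UnitAddCircle)) :
    ∫⁻ y in Ioc a (a + r), ∫⁻ z in Ioc b (b + r),
      ‖deriv (fun x : ℝ => γ x) y - deriv (fun x : ℝ => γ x) z‖ₑ ^ p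
      ≤ ENNReal.ofReal (C ^ (p - 2) * (2 * K) ^ (1 + s * p) * (tangentEnergy s p γ).toReal
        * r ^ (1 + s * p)) := by
  set q := 1 + s * p
  have hK' : (0 : ℝ) < K := hK
  set R := ENNReal.ofReal (2 * K * r)
  have hR0 : R ≠ 0 := by simp only [R, ne_eq, ENNReal.ofReal_eq_zero, not_le]; positivity
  have hcR : ENNReal.ofReal (C ^ (p - 2)) * R ^ q ≠ ⊤ :=
    ENNReal.mul_ne_top ENNReal.ofReal_ne_top
      (ENNReal.rpow_ne_top_of_nonneg hsp ENNReal.ofReal_ne_top)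
  have hdist : ∀ y ∈ Ioc a (a + r), ∀ z ∈ Ioc b (b + r),
      ‖γ (y : UnitAddCircle) - γ (z : UnitAddCircle)‖ₑ ≤ R := by
    intro y hy z hz
    rw [← ofReal_norm]
    refine ENNReal.ofReal_le_ofReal ?_
    have h1 := (lipschitzWith_lift hγ).dist_le_mul y a
    have h2 := (lipschitzWith_lift hγ).dist_le_mul b z
    have h3 : dist y a ≤ r := by rw [Real.dist_eq, abs_le]; constructor <;> linarith [hy.1, hy.2]
    have h4 : dist b z ≤ r := by rw [Real.dist_eq, abs_le]; constructor <;> linarith [hz.1, hz.2]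
    have h5 := dist_triangle (γ (y : UnitAddCircle)) (γ (a : UnitAddCircle)) (γ (z : UnitAddCircle))
    rw [← dist_eq_norm]
    rw [← hab] at h2
    nlinarith
  have hmain : ∫⁻ y in Ioc a (a + r), ∫⁻ z in Ioc b (b + r),
      ‖deriv (fun x : ℝ => γ x) y - deriv (fun x : ℝ => γ x) z‖ₑ ^ p
      ≤ ENNReal.ofReal (C ^ (p - 2)) * R ^ q * tangentEnergy s p γ := by
    rw [tangentEnergy]
    refine le_trans ?_ (mul_le_mul_right (setLIntegral_lift_le _ a hr1) _)
    rw [← lintegral_const_mul' _ _ hcR]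
    refine lintegral_mono_ae ?_
    filter_upwards [ae_norm_deriv_lift hspeed a hr1, ae_restrict_mem measurableSet_Ioc] with y hy hy'
    refine le_trans ?_ (mul_le_mul_right (setLIntegral_lift_le _ b hr1) _)
    rw [← lintegral_const_mul' _ _ hcR]
    refine lintegral_mono_ae ?_
    filter_upwards [ae_norm_deriv_lift hspeed b hr1, ae_restrict_mem measurableSet_Ioc] with z hz hz'
    rw [← circleDeriv_coe, ← circleDeriv_coe]
    exact enorm_circleDeriv_sub_rpow_le hC hp hsp hy hz hR0 ENNReal.ofReal_ne_top
      (hdist y hy' z hz')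
  refine hmain.trans (le_of_eq ?_)
  rw [← ENNReal.ofReal_toReal hE, ENNReal.ofReal_rpow_of_pos (by positivity),
    ← ENNReal.ofReal_mul (by positivity), ← ENNReal.ofReal_mul (by positivity),
    Real.mul_rpow (by positivity) hr.le, ENNReal.toReal_ofReal ENNReal.toReal_nonneg]
  congr 1
  ring

theorem tangentEnergy_ne_top_of_energyG_ne_top {γ : UnitAddCircle → ℂ} {s p δ : ℝ} (hδ : 0 < δ)
    (h : energyG s p δ γ ≠ ⊤) : tangentEnergy s p γ ≠ ⊤ := by
  intro hE
  apply h
  rw [energyG, hE, ENNReal.mul_top (by simpa using hδ)]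
  simp

/-- A constant speed curve of finite tangent energy is of class `C^1`. -/
theorem exists_continuous_hasDerivAt_of_tangentEnergy {γ : UnitAddCircle → ℂ} {K : NNReal}
    (hγ : LipschitzWith K γ) (hK : 0 < K) {C s p : ℝ} (hC : 0 < C)
    (hspeed : ∀ᵐ t : UnitAddCircle, ‖circleDeriv γ t‖ = C) (hp : 1 < p) (hsp : 1 < s * p)
    (hE : tangentEnergy s p γ ≠ ⊤) :
    ∃ G : ℝ → ℂ, Continuous G ∧ ∀ x, HasDerivAt (fun x : ℝ => γ x) (G x) x :=
  -- The diagonal case a = b of the square estimate, with Campanato exponent q = sp.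
  exists_continuous_hasDerivAt_of_campanato (lipschitzWith_lift hγ) hp hsp (by positivity)
    fun _ _ hr hr1 => lintegral_square_enorm_deriv_sub_rpow_le hγ hK hC hspeed (by linarith)
      (by linarith) hE hr hr1 rfl

theorem continuous_of_continuous_lift {X : Type*} [TopologicalSpace X] {u : UnitAddCircle → X}
    (h : Continuous fun x : ℝ => u x) : Continuous u :=
  QuotientAddGroup.isOpenQuotientMap_mk.isQuotientMap.continuous_iff.2 h

theorem continuous_circleDeriv {γ : UnitAddCircle → ℂ} {G : ℝ → ℂ} (hG : Continuous G)
    (h : ∀ x, HasDerivAt (fun x : ℝ => γ x) (G x) x) : Continuous (circleDeriv γ) := by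
  refine continuous_of_continuous_lift ?_
  simp only [circleDeriv_coe]
  rwa [funext fun x => (h x).deriv]

theorem norm_circleDeriv_eq {γ : UnitAddCircle → ℂ} {C : ℝ} (hc : Continuous (circleDeriv γ))
    (hspeed : ∀ᵐ t : UnitAddCircle, ‖circleDeriv γ t‖ = C) (t : UnitAddCircle) :
    ‖circleDeriv γ t‖ = C :=
  congrFun ((Continuous.ae_eq_iff_eq volume hc.norm continuous_const).1 hspeed) t

/-- At a self-intersection of a curve of finite tangent energy both velocities agree. -/
theorem deriv_eq_of_tangentEnergy {γ : UnitAddCircle → ℂ} {K : NNReal}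
    (hγ : LipschitzWith K γ) (hK : 0 < K) {C s p : ℝ} (hC : 0 < C)
    (hspeed : ∀ᵐ t : UnitAddCircle, ‖circleDeriv γ t‖ = C) (hp : 1 < p) (hsp : 1 < s * p)
    (hE : tangentEnergy s p γ ≠ ⊤) {G : ℝ → ℂ} (hG : Continuous G)
    (hd : ∀ x, HasDerivAt (fun x : ℝ => γ x) (G x) x) {a b : ℝ}
    (hab : γ (a : UnitAddCircle) = γ (b : UnitAddCircle)) : G a = G b := by
  by_contra hne
  set c := ‖G a - G b‖ / 2 with hc_def
  have hc : 0 < c := half_pos (norm_pos_iff.2 (sub_ne_zero.2 hne))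
  set M := C ^ (p - 2) * (2 * K) ^ (1 + s * p) * (tangentEnergy s p γ).toReal
  have hnear : ∀ᶠ x : ℝ × ℝ in 𝓝 (a, b), c < ‖G x.1 - G x.2‖ := by
    have h1 : ContinuousAt (fun x : ℝ × ℝ => ‖G x.1 - G x.2‖) (a, b) := by fun_prop
    exact h1.eventually (lt_mem_nhds (by simp only; linarith))
  rw [Metric.eventually_nhds_iff] at hnear
  obtain ⟨ρ, hρ, hnear⟩ := hnear
  -- On a square of side r the integral is at least c^p r² and at most M r^(1+sp).
  have key : ∀ r : ℝ, 0 < r → r ≤ 1 → r < ρ → c ^ p ≤ M * r ^ (s * p - 1) := by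
    intro r hr hr1 hrρ
    have h1 := lintegral_square_enorm_deriv_sub_rpow_le hγ hK hC hspeed (by linarith : 0 < p)
      (by linarith : 0 ≤ 1 + s * p) hE hr hr1 hab
    have h2 : ENNReal.ofReal (c ^ p * (r * r)) ≤ ∫⁻ y in Ioc a (a + r), ∫⁻ z in Ioc b (b + r),
        ‖deriv (fun x : ℝ => γ x) y - deriv (fun x : ℝ => γ x) z‖ₑ ^ p := by
      have : ENNReal.ofReal (c ^ p * (r * r)) = ∫⁻ _ in Ioc a (a + r), ∫⁻ _ in Ioc b (b + r),
          ENNReal.ofReal c ^ p := by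
        simp only [lintegral_const, MeasurableSet.univ, Measure.restrict_apply, univ_inter,
          Real.volume_Ioc, add_sub_cancel_left]
        rw [ENNReal.ofReal_mul (by positivity), ENNReal.ofReal_mul hr.le,
          ENNReal.ofReal_rpow_of_pos hc, mul_assoc]
      rw [this]
      refine setLIntegral_mono' measurableSet_Ioc fun y hy => ?_
      refine setLIntegral_mono' measurableSet_Ioc fun z hz => ?_
      refine ENNReal.rpow_le_rpow ?_ (by linarith)
      rw [(hd y).deriv, (hd z).deriv, ← ofReal_norm]
      refine ENNReal.ofReal_le_ofReal (hnear (y := (y, z)) ?_).le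
      rw [Prod.dist_eq, max_lt_iff, Real.dist_eq, Real.dist_eq, abs_lt, abs_lt]
      refine ⟨⟨?_, ?_⟩, ?_, ?_⟩ <;> simp only <;> linarith [hy.1, hy.2, hz.1, hz.2]
    have h3 := (ENNReal.ofReal_le_ofReal_iff (by positivity)).1 (h2.trans h1)
    have h4 : r ^ (1 + s * p) = r ^ (s * p - 1) * (r * r) := by
      rw [show 1 + s * p = s * p - 1 + 1 + 1 by ring, Real.rpow_add_one hr.ne',
        Real.rpow_add_one hr.ne', mul_assoc]
    have h5 : c ^ p * (r * r) ≤ M * r ^ (s * p - 1) * (r * r) := by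
      rw [mul_assoc M, ← h4]
      exact h3
    exact le_of_mul_le_mul_right h5 (by positivity)
  have hlim : Tendsto (fun r : ℝ => M * r ^ (s * p - 1)) (𝓝[>] 0) (𝓝 0) := by
    have h1 : ContinuousAt (fun r : ℝ => M * r ^ (s * p - 1)) 0 :=
      continuousAt_const.mul (Real.continuousAt_rpow_const _ _ (Or.inr (by linarith)))
    have h2 := h1.tendsto
    rw [Real.zero_rpow (by linarith), mul_zero] at h2
    exact h2.mono_left nhdsWithin_le_nhds
  have h5 : c ^ p ≤ 0 := by
    refine ge_of_tendsto hlim ?_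
    filter_upwards [Ioo_mem_nhdsGT (lt_min hρ one_pos)] with r hr
    exact key r hr.1 (hr.2.le.trans (min_le_right _ _)) (hr.2.trans_le (min_le_left _ _))
  exact absurd h5 (not_le.2 (Real.rpow_pos_of_pos hc _))

/-- A transversal self-intersection has infinite energy. -/
theorem energyG_eq_top_of_transversal {γ : UnitAddCircle → ℂ} {K : NNReal}
    (hγ : LipschitzWith K γ) (hK : 0 < K) {C s p δ : ℝ} (hC : 0 < C)
    (hspeed : ∀ᵐ t : UnitAddCircle, ‖circleDeriv γ t‖ = C) (hp : 1 < p) (hsp : 1 < s * p)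
    (hδ : 0 < δ) {t₁ t₂ : UnitAddCircle} {d₁ d₂ : ℂ} (ht : γ t₁ = γ t₂)
    (h₁ : HasCircleDerivAt γ d₁ t₁) (h₂ : HasCircleDerivAt γ d₂ t₂) (hne : d₁ ≠ d₂) :
    energyG s p δ γ = ⊤ := by
  by_contra hfin
  have hE := tangentEnergy_ne_top_of_energyG_ne_top hδ hfin
  obtain ⟨G, hG, hd⟩ := exists_continuous_hasDerivAt_of_tangentEnergy hγ hK hC hspeed hp hsp hE
  obtain ⟨a, rfl⟩ := QuotientAddGroup.mk_surjective t₁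
  obtain ⟨b, rfl⟩ := QuotientAddGroup.mk_surjective t₂
  have key : ∀ (x : ℝ) (d : ℂ), HasCircleDerivAt γ d (x : UnitAddCircle) → d = G x := by
    intro x d h
    have e : circleDeriv γ (x : UnitAddCircle) = d := HasDerivAt.deriv h
    rw [← e, circleDeriv_coe, (hd x).deriv]
  apply hne
  rw [key a d₁ h₁, key b d₂ h₂]
  exact deriv_eq_of_tangentEnergy hγ hK hC hspeed hp hsp hE hG hd ht

/-! ### Poisson kernels, the jump of the winding number, and injectivity -/

theorem Function.Periodic.uniformContinuous_of_continuous_one {G : ℝ → ℂ}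
    (hper : Function.Periodic G 1) (hG : Continuous G) : UniformContinuous G := by
  have hc : Continuous (hper.lift : UnitAddCircle → ℂ) := continuous_of_continuous_lift hG
  exact (CompactSpace.uniformContinuous_of_continuous hc).comp
    UnitAddCircle.lipschitzWith_coe.uniformContinuous

/-- Uniform first order expansion of a periodic `C^1` curve. -/
theorem exists_uniform_linearization {w W : ℝ → ℂ} (hper : Function.Periodic W 1)
    (hW : Continuous W) (hw : ∀ x, HasDerivAt w (W x) x) {η : ℝ} (hη : 0 < η) :
    ∃ δ > 0, ∀ x y : ℝ, |y - x| ≤ δ →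
      ‖W y - W x‖ ≤ η ∧ ‖w y - w x - (y - x) • W x‖ ≤ η * |y - x| := by
  obtain ⟨δ, hδ, h⟩ :=
    Metric.uniformContinuous_iff.1 (hper.uniformContinuous_of_continuous_one hW) η hη
  have h' : ∀ x y : ℝ, |y - x| ≤ δ / 2 → ‖W y - W x‖ ≤ η := by
    intro x y hxy
    rw [← dist_eq_norm]
    exact (h (by rw [Real.dist_eq]; linarith)).le
  refine ⟨δ / 2, half_pos hδ, fun x y hxy => ⟨h' x y hxy, ?_⟩⟩
  -- The mean value inequality is applied to w minus its linearization at x.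
  have hd : ∀ z ∈ uIcc x y, HasDerivWithinAt (fun z => w z - (z - x) • W x) (W z - W x)
      (uIcc x y) z := by
    intro z _
    have h1 := ((hasDerivAt_id' z).sub_const x).smul_const (W x)
    simpa using ((hw z).fun_sub h1).hasDerivWithinAt
  have hb : ∀ z ∈ uIcc x y, ‖W z - W x‖ ≤ η := fun z hz =>
    h' x z ((abs_sub_left_of_mem_uIcc hz).trans hxy)
  have := (convex_uIcc x y).norm_image_sub_le_of_norm_hasDerivWithin_le hd hb
    left_mem_uIcc right_mem_uIcc
  simpa [sub_right_comm] using this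

/-- Where a periodic curve is close to `0`, the parameter is close to a zero. -/
theorem exists_near_zero_of_norm_lt {w : ℝ → ℂ} (hper : Function.Periodic w 1)
    (hw : Continuous w) {δ : ℝ} (hδ : 0 < δ) :
    ∃ ρ > 0, ∀ x, ‖w x‖ < ρ → ∃ z, w z = 0 ∧ |x - z| ≤ δ := by
  -- On this compact set |w| has a positive minimum. The zeros range over all of ℝ, so those just
  -- outside [0, 1] are removed as well.
  set S : Set ℝ := Icc 0 1 \ ⋃ z ∈ {z | w z = 0}, Metric.ball z δ with hS
  have hSc : IsCompact S :=
    isCompact_Icc.diff (isOpen_biUnion fun _ _ => Metric.isOpen_ball)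
  have key : ∃ ρ > 0, ∀ x ∈ S, ρ ≤ ‖w x‖ := by
    rcases S.eq_empty_or_nonempty with hS0 | hS0
    · exact ⟨1, one_pos, by simp [hS0]⟩
    · obtain ⟨x₀, hx₀, hmin⟩ := hSc.exists_isMinOn hS0 hw.norm.continuousOn
      refine ⟨‖w x₀‖, norm_pos_iff.2 fun h0 => hx₀.2 ?_, fun x hx => hmin hx⟩
      exact mem_biUnion (show x₀ ∈ {z | w z = 0} from h0) (Metric.mem_ball_self hδ)
  obtain ⟨ρ, hρ, h⟩ := key
  refine ⟨ρ, hρ, fun x hx => ?_⟩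
  have hfr : w (Int.fract x) = w x := by
    have := hper.sub_int_mul_eq (x := x) ⌊x⌋
    rwa [mul_one] at this
  have hnot : Int.fract x ∉ S := fun hm => absurd (h _ hm) (by rw [hfr]; exact not_le.2 hx)
  have hmem : Int.fract x ∈ Icc (0 : ℝ) 1 := ⟨Int.fract_nonneg x, (Int.fract_lt_one x).le⟩
  have : Int.fract x ∈ ⋃ z ∈ {z | w z = 0}, Metric.ball z δ := by
    by_contra hcon
    exact hnot ⟨hmem, hcon⟩
  simp only [mem_iUnion, Metric.mem_ball, Real.dist_eq, mem_ofPred_eq] at this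
  obtain ⟨z, hz, hzx⟩ := this
  refine ⟨z + ⌊x⌋, ?_, ?_⟩
  · have := hper.int_mul ⌊x⌋ z
    rw [mul_one] at this
    rw [this]; exact hz
  · rw [show x - (z + ⌊x⌋) = Int.fract x - z by rw [Int.fract]; ring]
    exact hzx.le

/-- The complex Poisson type kernel near a zero of the curve. -/
theorem poisson_kernel_lower_bound {W w : ℂ} {h ε : ℝ} (hε : 0 < ε) (hW : ‖W - 1‖ ≤ 1 / 20)
    (hw : ‖w - h‖ ≤ 1 / 20 * |h|) :
    w ^ 2 + (ε : ℂ) ^ 2 ≠ 0 ∧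
      3 / 4 * (ε / (h ^ 2 + ε ^ 2)) ≤ (W * ε / (w ^ 2 + (ε : ℂ) ^ 2)).re := by
  set D := w ^ 2 + (ε : ℂ) ^ 2 with hD
  set D₀ : ℝ := h ^ 2 + ε ^ 2 with hD0
  have hD0pos : 0 < D₀ := by positivity
  have h1 : ‖D - (D₀ : ℂ)‖ ≤ 3 / 20 * D₀ := by
    have e : D - (D₀ : ℂ) = (w - h) * ((w - h) + 2 * h) := by
      rw [hD, hD0]; push_cast; ring
    rw [e, norm_mul]
    have h2 : ‖(w - h) + 2 * (h : ℂ)‖ ≤ 3 * |h| := by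
      refine (norm_add_le _ _).trans ?_
      rw [norm_mul, Complex.norm_real, Real.norm_eq_abs]
      norm_num
      linarith [abs_nonneg h]
    calc _ ≤ (1 / 20 * |h|) * (3 * |h|) := by gcongr
      _ = 3 / 20 * |h| ^ 2 := by ring
      _ ≤ 3 / 20 * D₀ := by rw [sq_abs, hD0]; nlinarith [sq_nonneg ε]
  have h2 : 17 / 20 * D₀ ≤ ‖D‖ := by
    have h3 : ‖(D₀ : ℂ)‖ = D₀ := by rw [Complex.norm_real, Real.norm_of_nonneg hD0pos.le]
    have h4 := norm_sub_norm_le (D₀ : ℂ) (D₀ - D)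
    rw [sub_sub_cancel, h3, norm_sub_rev] at h4
    linarith
  have hDpos : 0 < ‖D‖ := by linarith
  have hDne : D ≠ 0 := norm_pos_iff.1 hDpos
  refine ⟨hDne, ?_⟩
  have hD0ne : (D₀ : ℂ) ≠ 0 := by exact_mod_cast hD0pos.ne'
  -- The relative error is at most (1/20 + 3/20) / (17/20) = 4/17 < 1/4.
  have h5 : ‖W * ε / D - ε / D₀‖ ≤ 1 / 4 * (ε / D₀) := by
    have e : W * ε / D - ε / D₀ = ε / D₀ * (((W - 1) * D₀ + (D₀ - D)) / D) := by
      field_simp; ring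
    have h6 : ‖(W - 1) * D₀ + (D₀ - D)‖ ≤ 4 / 20 * D₀ := by
      refine (norm_add_le _ _).trans ?_
      rw [norm_mul, Complex.norm_real, Real.norm_of_nonneg hD0pos.le, norm_sub_rev (D₀ : ℂ)]
      nlinarith
    rw [e, norm_mul, norm_div, norm_div, Complex.norm_real, Complex.norm_real,
      Real.norm_of_nonneg hD0pos.le, Real.norm_of_nonneg hε.le, mul_comm]
    refine mul_le_mul_of_nonneg_right ?_ (by positivity)
    rw [div_le_iff₀ hDpos]
    linarith
  have h7 := (Complex.abs_re_le_norm _).trans h5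
  rw [Complex.sub_re, show ((ε : ℂ) / D₀).re = ε / D₀ by
    rw [← Complex.ofReal_div, Complex.ofReal_re]] at h7
  linarith [(abs_le.1 h7).1]

/-- For fixed h > 0 the value tends to π as ε → 0⁺: the mass contributed by one zero. -/
theorem integral_poisson_kernel {a h ε : ℝ} (hε : 0 < ε) :
    ∫ x in (a - h)..(a + h), ε / ((x - a) ^ 2 + ε ^ 2) = 2 * Real.arctan (h / ε) := by
  have hd : ∀ x ∈ uIcc (a - h) (a + h), HasDerivAt (fun x => Real.arctan ((x - a) / ε))
      (ε / ((x - a) ^ 2 + ε ^ 2)) x := by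
    intro x _
    have h1 := (((hasDerivAt_id' x).sub_const a).div_const ε).arctan
    convert h1 using 1
    field_simp
    ring
  have hc : Continuous fun x => ε / ((x - a) ^ 2 + ε ^ 2) :=
    continuous_const.div (by fun_prop) fun x => by positivity
  rw [intervalIntegral.integral_eq_sub_of_hasDerivAt hd (hc.intervalIntegrable _ _)]
  rw [show (a + h - a) / ε = h / ε by ring, show (a - h - a) / ε = -(h / ε) by ring,
    Real.arctan_neg]
  ring

/-- Two zeros per period of a periodic `C^1` curve that crosses `0` only with velocity `1` make the
real part of the Poisson type integral exceed `π`. -/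
theorem eventually_pi_lt_re_integral {w W : ℝ → ℂ} (hperw : Function.Periodic w 1)
    (hper : Function.Periodic W 1) (hW : Continuous W) (hw : ∀ x, HasDerivAt w (W x) x)
    (hone : ∀ z, w z = 0 → W z = 1) {a b : ℝ} (hab : a < b) (hb1 : b < a + 1)
    (ha : w a = 0) (hb : w b = 0) :
    ∀ᶠ ε : ℝ in 𝓝[>] 0, (∀ x, w x ^ 2 + (ε : ℂ) ^ 2 ≠ 0) ∧ ∀ t : ℝ,
      Real.pi < (∫ x in t..(t + 1), W x * ε / (w x ^ 2 + (ε : ℂ) ^ 2)).re := by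
  have hwc : Continuous w := continuous_iff_continuousAt.2 fun x => (hw x).continuousAt
  obtain ⟨δ, hδ, hlin⟩ := exists_uniform_linearization hper hW hw (η := 1 / 20) (by norm_num)
  obtain ⟨ρ, hρ, hnear⟩ := exists_near_zero_of_norm_lt hperw hwc hδ
  obtain ⟨A, hA⟩ : ∃ A, ∀ x, ‖W x‖ ≤ A := by
    have hc : Continuous (hper.lift : UnitAddCircle → ℂ) := continuous_of_continuous_lift hW
    obtain ⟨A, hA⟩ := (isCompact_range hc).isBounded.exists_norm_le
    exact ⟨A, fun x => hA _ ⟨(x : UnitAddCircle), rfl⟩⟩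
  have hA0 : 0 ≤ A := (norm_nonneg _).trans (hA 0)
  have hloc : ∀ (ε : ℝ), 0 < ε → ∀ z x, w z = 0 → |x - z| ≤ δ →
      w x ^ 2 + (ε : ℂ) ^ 2 ≠ 0 ∧ 3 / 4 * (ε / ((x - z) ^ 2 + ε ^ 2))
        ≤ (W x * ε / (w x ^ 2 + (ε : ℂ) ^ 2)).re := by
    intro ε hε z x hz hx
    obtain ⟨h1, h2⟩ := hlin z x hx
    rw [hone z hz] at h1 h2
    rw [hz, sub_zero] at h2
    refine poisson_kernel_lower_bound hε h1 ?_
    simpa using h2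
  have hfar : ∀ (ε : ℝ), 0 < ε → ε ^ 2 ≤ ρ ^ 2 / 2 → ∀ x, ρ ≤ ‖w x‖ →
      w x ^ 2 + (ε : ℂ) ^ 2 ≠ 0 ∧
        -(2 * A / ρ ^ 2 * ε) ≤ (W x * ε / (w x ^ 2 + (ε : ℂ) ^ 2)).re := by
    intro ε hε hερ x hx
    have h1 : ρ ^ 2 / 2 ≤ ‖w x ^ 2 + (ε : ℂ) ^ 2‖ := by
      have h2 := norm_sub_norm_le (w x ^ 2) (-(ε : ℂ) ^ 2)
      rw [norm_neg, norm_pow, norm_pow, Complex.norm_real, Real.norm_of_nonneg hε.le,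
        sub_neg_eq_add] at h2
      nlinarith
    have h3 : 0 < ‖w x ^ 2 + (ε : ℂ) ^ 2‖ := lt_of_lt_of_le (by positivity) h1
    refine ⟨norm_pos_iff.1 h3, ?_⟩
    have h4 : ‖W x * ε / (w x ^ 2 + (ε : ℂ) ^ 2)‖ ≤ 2 * A / ρ ^ 2 * ε := by
      rw [norm_div, norm_mul, Complex.norm_real, Real.norm_of_nonneg hε.le]
      calc ‖W x‖ * ε / ‖w x ^ 2 + (ε : ℂ) ^ 2‖ ≤ A * ε / (ρ ^ 2 / 2) := by
            gcongr
            exact hA x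
        _ = _ := by ring
    exact (abs_le.1 ((Complex.abs_re_le_norm _).trans h4)).1
  -- The windows of radius h around a and b do not overlap, both fit in the period starting at a -
  -- h, and linearization holds on them.
  set h : ℝ := min δ (min ((b - a) / 2) ((a + 1 - b) / 2)) with hh
  have hh0 : 0 < h := lt_min hδ (lt_min (by linarith) (by linarith))
  have hhδ : h ≤ δ := min_le_left _ _
  have hh1 : h ≤ (b - a) / 2 := (min_le_right _ _).trans (min_le_left _ _)
  have hh2 : h ≤ (a + 1 - b) / 2 := (min_le_right _ _).trans (min_le_right _ _)
  -- Each window gives at least (3/4) · 2 arctan(h/ε), and the rest of the period loses O(ε). The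
  -- limit 3π/2 exceeds π; any kernel constant above 1/2 would do.
  have hlim : Tendsto (fun ε : ℝ => 3 * Real.arctan (h / ε) - 2 * A / ρ ^ 2 * ε) (𝓝[>] 0)
      (𝓝 (3 * (Real.pi / 2) - 2 * A / ρ ^ 2 * 0)) := by
    refine Tendsto.sub (Tendsto.const_mul _ ?_) (Tendsto.const_mul _ ?_)
    · have h1 : Tendsto (fun ε : ℝ => h / ε) (𝓝[>] 0) atTop := by
        simp only [div_eq_mul_inv]
        exact tendsto_inv_nhdsGT_zero.const_mul_atTop hh0
      exact (Real.tendsto_arctan_atTop.mono_right nhdsWithin_le_nhds).comp h1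
    · exact tendsto_id.mono_left nhdsWithin_le_nhds
  have hgt : Real.pi < 3 * (Real.pi / 2) - 2 * A / ρ ^ 2 * 0 := by linarith [Real.pi_pos]
  filter_upwards [hlim.eventually (lt_mem_nhds hgt), Ioo_mem_nhdsGT (half_pos hρ)] with ε h1 h2
  have hε : 0 < ε := h2.1
  have hερ : ε ^ 2 ≤ ρ ^ 2 / 2 := by nlinarith [h2.2]
  set B := 2 * A / ρ ^ 2 * ε with hB
  have hB0 : 0 ≤ B := by positivity
  set Φ : ℝ → ℂ := fun x => W x * ε / (w x ^ 2 + (ε : ℂ) ^ 2) with hΦ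
  -- Near any further zero the real part is nonnegative, so zeros need not be counted or isolated.
  have hall : ∀ x, w x ^ 2 + (ε : ℂ) ^ 2 ≠ 0 ∧ -B ≤ (Φ x).re := by
    intro x
    rcases lt_or_ge ‖w x‖ ρ with hx | hx
    · obtain ⟨z, hz, hxz⟩ := hnear x hx
      obtain ⟨h3, h4⟩ := hloc ε hε z x hz hxz
      refine ⟨h3, le_trans ?_ h4⟩
      have : 0 ≤ 3 / 4 * (ε / ((x - z) ^ 2 + ε ^ 2)) := by positivity
      linarith
    · exact hfar ε hε hερ x hx
  refine ⟨fun x => (hall x).1, fun t => ?_⟩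
  have hΦc : Continuous Φ := (hW.mul continuous_const).div (by fun_prop) fun x => (hall x).1
  have hΦper : Function.Periodic Φ 1 := fun x => by simp only [hΦ, hper x, hperw x]
  have hrec : Continuous fun x => (Φ x).re := Complex.continuous_re.comp hΦc
  have hi : ∀ c d, IntervalIntegrable (fun x => (Φ x).re) volume c d := fun c d =>
    hrec.intervalIntegrable c d
  rw [hΦper.intervalIntegral_add_eq t (a - h)]
  have hre : (∫ x in (a - h)..(a - h + 1), Φ x).re = ∫ x in (a - h)..(a - h + 1), (Φ x).re :=
    (Complex.reCLM.intervalIntegral_comp_comm (hΦc.intervalIntegrable _ _)).symm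
  have hsmall : ∀ c d, c ≤ d → -B * (d - c) ≤ ∫ x in c..d, (Φ x).re := by
    intro c d hcd
    have := intervalIntegral.integral_mono_on hcd intervalIntegrable_const (hi c d)
      fun x _ => (hall x).2
    rw [intervalIntegral.integral_const, smul_eq_mul] at this
    linarith
  have hbig : ∀ z, w z = 0 → 3 / 2 * Real.arctan (h / ε) ≤ ∫ x in (z - h)..(z + h), (Φ x).re := by
    intro z hz
    have hc : Continuous fun x => 3 / 4 * (ε / ((x - z) ^ 2 + ε ^ 2)) :=
      continuous_const.mul (continuous_const.div (by fun_prop) fun x => by positivity)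
    have := intervalIntegral.integral_mono_on (by linarith : z - h ≤ z + h)
      (hc.intervalIntegrable _ _) (hi _ _) fun x hx => (hloc ε hε z x hz (by
        rw [abs_le]; constructor <;> linarith [hx.1, hx.2])).2
    rw [intervalIntegral.integral_const_mul, integral_poisson_kernel hε] at this
    linarith
  rw [hre, ← intervalIntegral.integral_add_adjacent_intervals (hi (a - h) (a + h)) (hi _ _),
    ← intervalIntegral.integral_add_adjacent_intervals (hi (a + h) (b - h)) (hi _ _),
    ← intervalIntegral.integral_add_adjacent_intervals (hi (b - h) (b + h)) (hi _ _)]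
  have i1 := hbig a ha
  have i2 := hbig b hb
  have i3 := hsmall (a + h) (b - h) (by linarith)
  have i4 := hsmall (b + h) (a - h + 1) (by linarith)
  nlinarith

theorem periodic_lift {X : Type*} (u : UnitAddCircle → X) :
    Function.Periodic (fun x : ℝ => u (x : UnitAddCircle)) 1 := fun x => by
  simp only [AddCircle.coe_add_period]

theorem windingNumber_eq_intervalIntegral {γ : UnitAddCircle → ℂ} {G : ℝ → ℂ}
    (hd : ∀ x, HasDerivAt (fun x : ℝ => γ x) (G x) x) (z : ℂ) :
    windingNumber γ z = (2 * Real.pi * Complex.I)⁻¹ *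
      ∫ x in (0 : ℝ)..(0 + 1), G x / (γ (x : UnitAddCircle) - z) := by
  rw [windingNumber, ← UnitAddCircle.intervalIntegral_preimage 0]
  simp only [circleDeriv_coe, (hd _).deriv]

/-- The jump of the winding number across the curve as a Poisson type integral. -/
theorem windingNumber_sub_windingNumber {γ : UnitAddCircle → ℂ} {G : ℝ → ℂ} (hG : Continuous G)
    (hd : ∀ x, HasDerivAt (fun x : ℝ => γ x) (G x) x) {c d : ℂ} (hd0 : d ≠ 0) {ε : ℝ}
    (hne : ∀ x : ℝ, ((γ (x : UnitAddCircle) - c) / d) ^ 2 + (ε : ℂ) ^ 2 ≠ 0) :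
    windingNumber γ (c + ε * Complex.I * d) - windingNumber γ (c - ε * Complex.I * d)
      = (Real.pi⁻¹ : ℝ) * ∫ x in (0 : ℝ)..(0 + 1),
        G x / d * ε / (((γ (x : UnitAddCircle) - c) / d) ^ 2 + (ε : ℂ) ^ 2) := by
  have hf : Continuous fun x : ℝ => γ (x : UnitAddCircle) :=
    continuous_iff_continuousAt.2 fun x => (hd x).continuousAt
  have hfac : ∀ x : ℝ, ((γ (x : UnitAddCircle) - c) / d) ^ 2 + (ε : ℂ) ^ 2
      = (γ (x : UnitAddCircle) - (c + ε * Complex.I * d))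
        * (γ (x : UnitAddCircle) - (c - ε * Complex.I * d)) / d ^ 2 := by
    intro x
    field_simp
    linear_combination ((ε : ℂ) ^ 2 * d ^ 2) * Complex.I_sq
  have h12 : ∀ x : ℝ, γ (x : UnitAddCircle) - (c + ε * Complex.I * d) ≠ 0 ∧
      γ (x : UnitAddCircle) - (c - ε * Complex.I * d) ≠ 0 := by
    intro x
    have := hne x
    rw [hfac x] at this
    constructor <;> rintro h <;> simp [h] at this
  have hc1 : Continuous fun x : ℝ => G x / (γ (x : UnitAddCircle) - (c + ε * Complex.I * d)) :=
    hG.div (hf.sub continuous_const) fun x => (h12 x).1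
  have hc2 : Continuous fun x : ℝ => G x / (γ (x : UnitAddCircle) - (c - ε * Complex.I * d)) :=
    hG.div (hf.sub continuous_const) fun x => (h12 x).2
  rw [windingNumber_eq_intervalIntegral hd, windingNumber_eq_intervalIntegral hd, ← mul_sub,
    ← intervalIntegral.integral_sub (hc1.intervalIntegrable _ _) (hc2.intervalIntegrable _ _),
    ← intervalIntegral.integral_const_mul, ← intervalIntegral.integral_const_mul]
  refine intervalIntegral.integral_congr fun x _ => ?_
  have hpi : (Real.pi : ℂ) ≠ 0 := by exact_mod_cast Real.pi_ne_zero
  rw [hfac x]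
  obtain ⟨h1, h2⟩ := h12 x
  have hI := Complex.I_ne_zero
  push_cast
  generalize hu : γ (x : UnitAddCircle) - (c + ε * Complex.I * d) = u at h1 ⊢
  generalize hv : γ (x : UnitAddCircle) - (c - ε * Complex.I * d) = v at h2 ⊢
  -- In 1/u - 1/v = (v - u)/(uv) this numerator cancels the factor 2i of 2πi.
  have huv : v - u = 2 * ε * Complex.I * d := by rw [← hu, ← hv]; ring
  field_simp
  linear_combination G x * huv

/-- A `C^1` immersed closed curve with winding numbers in `{0, 1}` whose velocities agree at
self-intersections is injective. -/
theorem injective_of_windingNumber {γ : UnitAddCircle → ℂ} {G : ℝ → ℂ} (hG : Continuous G)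
    (hd : ∀ x, HasDerivAt (fun x : ℝ => γ x) (G x) x) (hG0 : ∀ x, G x ≠ 0)
    (hself : ∀ a b : ℝ, γ (a : UnitAddCircle) = γ (b : UnitAddCircle) → G a = G b)
    (hwind : ∀ x : ℂ, x ∉ Set.range γ → windingNumber γ x = 0 ∨ windingNumber γ x = 1) :
    Function.Injective γ := by
  have main : ∀ a b : ℝ, a < b → b < a + 1 →
      γ (a : UnitAddCircle) ≠ γ (b : UnitAddCircle) := by
    intro a b hab hb1 heq
    set c := γ (a : UnitAddCircle)
    set d := G a
    have hd0 : d ≠ 0 := hG0 a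
    have hperf := periodic_lift γ
    -- The parameters x and x + 1 have the same image, so `hself` applies to them too.
    have hperG : Function.Periodic G 1 := fun x => hself _ _ (hperf x)
    have hev := eventually_pi_lt_re_integral (w := fun x : ℝ => (γ (x : UnitAddCircle) - c) / d)
      (W := fun x => G x / d) (fun x => by simp only [AddCircle.coe_add_period])
      (fun x => by simp only [hperG x]) (hG.div_const d)
      (fun x => ((hd x).sub_const c).div_const d)
      (fun z hz => by
        have hz' : γ (z : UnitAddCircle) = c := by
          rcases div_eq_zero_iff.1 hz with h | h
          · exact sub_eq_zero.1 h
          · exact absurd h hd0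
        simp only [hself z a hz']
        exact div_self hd0)
      hab hb1 (by simp [c]) (by simp [← heq])
    obtain ⟨ε, ⟨hne, hint⟩, -⟩ := (hev.and self_mem_nhdsWithin).exists
    -- On the curve such a point would have w = εσ, making w² + ε² vanish.
    have hout : ∀ σ : ℂ, σ ^ 2 = -1 → c + ε * σ * d ∉ Set.range γ := by
      rintro σ hσ ⟨t, ht⟩
      obtain ⟨x, rfl⟩ := QuotientAddGroup.mk_surjective t
      apply hne x
      rw [show γ (x : UnitAddCircle) = c + ε * σ * d from ht, add_sub_cancel_left,
        mul_div_cancel_right₀ _ hd0, mul_pow, hσ]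
      ring
    have hjump := windingNumber_sub_windingNumber hG hd hd0 hne
    have hlt : 1 < (windingNumber γ (c + ε * Complex.I * d)
        - windingNumber γ (c - ε * Complex.I * d)).re := by
      rw [hjump, Complex.re_ofReal_mul, inv_mul_eq_div, lt_div_iff₀ Real.pi_pos, one_mul]
      exact hint 0
    have h1 := hwind _ (hout Complex.I Complex.I_sq)
    have h2 := hwind _ (hout (-Complex.I) (by rw [neg_sq, Complex.I_sq]))
    rw [show c + ε * -Complex.I * d = c - ε * Complex.I * d by ring] at h2
    rcases h1 with h1 | h1 <;> rcases h2 with h2 | h2 <;> rw [h1, h2] at hlt <;>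
      norm_num at hlt
  intro t t' htt
  obtain ⟨a, ha, rfl⟩ := AddCircle.eq_coe_Ico t
  obtain ⟨b, hb, rfl⟩ := AddCircle.eq_coe_Ico t'
  rcases lt_trichotomy a b with h | h | h
  · exact absurd htt (main a b h (by linarith [ha.1, hb.2]))
  · rw [h]
  · exact absurd htt.symm (main b a h (by linarith [hb.1, ha.2]))

/-! ### Bi-Lipschitz bound, Sobolev regularity and conclusion -/

/-- An injective periodic `C^1` immersion satisfies a lower Lipschitz bound. -/
theorem exists_lower_lipschitz_bound {γ : UnitAddCircle → ℂ} {G : ℝ → ℂ} (hG : Continuous G)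
    (hper : Function.Periodic G 1) (hd : ∀ x, HasDerivAt (fun x : ℝ => γ x) (G x) x) {C : ℝ}
    (hC : 0 < C) (hGC : ∀ x, ‖G x‖ = C) (hinj : Function.Injective γ) :
    ∃ m > 0, ∀ t t' : UnitAddCircle, m * ‖t - t'‖ ≤ ‖γ t - γ t'‖ := by
  have hγ : Continuous γ := continuous_of_continuous_lift
    (continuous_iff_continuousAt.2 fun x => (hd x).continuousAt)
  obtain ⟨δ, hδ, hlin⟩ := exists_uniform_linearization hper hG hd (half_pos hC)
  set S : Set (UnitAddCircle × UnitAddCircle) := {q | δ ≤ ‖q.1 - q.2‖} with hS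
  have hSc : IsCompact S :=
    (isClosed_le continuous_const (by fun_prop)).isCompact
  obtain ⟨m₀, hm₀, hfar⟩ : ∃ m₀ > 0, ∀ q ∈ S, m₀ ≤ ‖γ q.1 - γ q.2‖ := by
    rcases S.eq_empty_or_nonempty with h0 | h0
    · exact ⟨1, one_pos, by simp [h0]⟩
    · obtain ⟨q, hq, hmin⟩ := hSc.exists_isMinOn h0
        (f := fun q : UnitAddCircle × UnitAddCircle => ‖γ q.1 - γ q.2‖)
        (by fun_prop)
      refine ⟨_, norm_pos_iff.2 fun h => ?_, fun q' hq' => hmin hq'⟩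
      have h1 : δ ≤ ‖q.1 - q.2‖ := hq
      rw [hinj (sub_eq_zero.1 h), sub_self, norm_zero] at h1
      linarith
  refine ⟨min (C / 2) m₀, lt_min (half_pos hC) hm₀, fun t t' => ?_⟩
  rcases le_or_gt δ ‖t - t'‖ with h | h
  · refine le_trans ?_ (hfar (t, t') h)
    have h1 : ‖t - t'‖ ≤ 1 / 2 := by
      simpa using AddCircle.norm_le_half_period (1 : ℝ) (x := t - t') one_ne_zero
    have h2 := min_le_right (C / 2) m₀
    have h3 : 0 < min (C / 2) m₀ := lt_min (half_pos hC) hm₀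
    nlinarith [norm_nonneg (t - t')]
  · obtain ⟨x, rfl⟩ := QuotientAddGroup.mk_surjective t'
    obtain ⟨y, hy⟩ := QuotientAddGroup.mk_surjective (t - (x : UnitAddCircle))
    -- Subtracting `round y` picks the real representative whose absolute value is the circle
    -- distance.
    have ht : t = ((x + (y - round y) : ℝ) : UnitAddCircle) := by
      have h1 : ((round y : ℝ) : UnitAddCircle) = 0 :=
        (AddCircle.coe_eq_zero_iff 1).2 ⟨round y, by simp⟩
      rw [AddCircle.coe_add, AddCircle.coe_sub, h1, sub_zero,
        show (y : UnitAddCircle) = t - (x : UnitAddCircle) from hy]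
      abel
    have hn : ‖t - (x : UnitAddCircle)‖ = |y - round y| := by
      rw [← hy]; exact UnitAddCircle.norm_eq
    change ‖t - (x : UnitAddCircle)‖ < δ at h
    change _ * ‖t - (x : UnitAddCircle)‖ ≤ ‖γ t - γ (x : UnitAddCircle)‖
    rw [hn] at h ⊢
    have h2 := (hlin x (x + (y - round y)) (by rw [add_sub_cancel_left]; exact h.le)).2
    rw [← ht, add_sub_cancel_left] at h2
    have h3 := norm_sub_norm_le ((y - round y) • G x) ((y - round y) • G x -
      (γ t - γ (x : UnitAddCircle)))
    rw [sub_sub_cancel, norm_sub_rev, norm_smul, hGC, Real.norm_eq_abs] at h3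
    have h4 := min_le_left (C / 2) m₀
    have h5 := mul_le_mul_of_nonneg_right h4 (abs_nonneg (y - round y))
    linarith

/-- Integration by parts over one period; the boundary terms of φγ cancel by periodicity. -/
theorem isWeakCircleDeriv_circleDeriv {γ : UnitAddCircle → ℂ} {G : ℝ → ℂ} (hG : Continuous G)
    (hd : ∀ x, HasDerivAt (fun x : ℝ => γ x) (G x) x) :
    IsWeakCircleDeriv γ (circleDeriv γ) := by
  intro φ hφ
  have hf : Continuous fun x : ℝ => γ (x : UnitAddCircle) :=
    continuous_iff_continuousAt.2 fun x => (hd x).continuousAt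
  have hφ' : ContDiff ℝ ∞ fun x : ℝ => φ (x : UnitAddCircle) := hφ
  have hφc := hφ'.continuous
  have hφd := hφ'.continuous_deriv (by simp)
  have hdφ : ∀ x, HasDerivAt (fun x : ℝ => φ (x : UnitAddCircle))
      (deriv (fun x : ℝ => φ (x : UnitAddCircle)) x) x := fun x =>
    (hφ'.differentiable (by simp) x).hasDerivAt
  rw [← UnitAddCircle.intervalIntegral_preimage 0, ← UnitAddCircle.intervalIntegral_preimage 0,
    eq_neg_iff_add_eq_zero]
  simp only [circleDeriv_coe, (hd _).deriv]
  have h1 : IntervalIntegrable (fun x : ℝ => deriv (fun x : ℝ => φ (x : UnitAddCircle)) x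
      • γ (x : UnitAddCircle)) volume 0 (0 + 1) := (hφd.smul hf).intervalIntegrable _ _
  have h2 : IntervalIntegrable (fun x : ℝ => φ (x : UnitAddCircle) • G x) volume 0 (0 + 1) :=
    (hφc.smul hG).intervalIntegrable _ _
  rw [← intervalIntegral.integral_add h1 h2,
    intervalIntegral.integral_eq_sub_of_hasDerivAt
      (f := fun x : ℝ => φ (x : UnitAddCircle) • γ (x : UnitAddCircle))
      (fun x _ => by rw [add_comm]; exact (hdφ x).smul (hd x)) (h1.add h2)]
  simp only [zero_add, sub_eq_zero]
  have := periodic_lift (fun t => φ t • γ t) 0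
  simpa using this

/-- Since |γ(t) - γ(t')| ≤ K|t - t'|, the Gagliardo integrand of γ' is pointwise at most a constant
times the energy integrand. -/
theorem memFracSobolev_of_tangentEnergy {γ : UnitAddCircle → ℂ} {K : NNReal}
    (hγ : LipschitzWith K γ) (hK : 0 < K) {C s p : ℝ} (hC : 0 < C)
    (hspeed : ∀ t : UnitAddCircle, ‖circleDeriv γ t‖ = C) (hp : 1 < p) (hsp : 1 < s * p)
    (hE : tangentEnergy s p γ ≠ ⊤) {G : ℝ → ℂ} (hG : Continuous G)
    (hd : ∀ x, HasDerivAt (fun x : ℝ => γ x) (G x) x) : MemFracSobolev s p γ := by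
  have hmem : ∀ u : UnitAddCircle → ℂ, Continuous u → MemLp u (ENNReal.ofReal p) volume := by
    intro u hu
    obtain ⟨A, hA⟩ := (isCompact_range hu).isBounded.exists_norm_le
    exact MemLp.of_bound hu.aestronglyMeasurable A (Eventually.of_forall fun t => hA _ ⟨t, rfl⟩)
  refine ⟨hmem γ hγ.continuous, circleDeriv γ, hmem _ (continuous_circleDeriv hG hd),
    isWeakCircleDeriv_circleDeriv hG hd, ?_⟩
  set q := 1 + s * p with hq
  have hq0 : 0 < q := by linarith
  set c : ENNReal := ENNReal.ofReal (C ^ (p - 2)) * (K : ENNReal) ^ q with hc_def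
  have hc : c ≠ ⊤ := ENNReal.mul_ne_top ENNReal.ofReal_ne_top
    (ENNReal.rpow_ne_top_of_nonneg hq0.le ENNReal.coe_ne_top)
  refine lt_of_le_of_lt ?_ (ENNReal.mul_lt_top hc.lt_top hE.lt_top)
  rw [tangentEnergy, ← lintegral_const_mul' _ _ hc]
  refine lintegral_mono fun t => ?_
  rw [← lintegral_const_mul' _ _ hc]
  refine lintegral_mono fun t' => ?_
  -- The diagonal is separate because the comparison radius K|t - t'| must be nonzero.
  rcases eq_or_ne t t' with rfl | hne
  · simp [show 0 < p by linarith]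
  have hn0 : ‖t - t'‖ₑ ≠ 0 := by simpa [sub_eq_zero] using hne
  have hK0 : (K : ENNReal) ≠ 0 := by exact_mod_cast hK.ne'
  have hle : ‖γ t - γ t'‖ₑ ≤ K * ‖t - t'‖ₑ := by
    have := hγ t t'
    rwa [edist_eq_enorm_sub, edist_eq_enorm_sub] at this
  have h := enorm_circleDeriv_sub_rpow_le hC (by linarith : 0 < p) hq0.le (hspeed t) (hspeed t')
    (mul_ne_zero hK0 hn0) (ENNReal.mul_ne_top ENNReal.coe_ne_top enorm_ne_top) hle
  refine ENNReal.div_le_of_le_mul (h.trans (le_of_eq ?_))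
  rw [ENNReal.mul_rpow_of_nonneg _ _ hq0.le, hc_def]
  ring

theorem theorem1p2 (γ : UnitAddCircle → ℂ) (hLip : ∃ K : NNReal, LipschitzWith K γ)
    (hspeed : HasConstantSpeed γ)
    (s p δ : ℝ) (hs : s ∈ Set.Ioo (0 : ℝ) 1) (hp : 1 < p) (hsp : 1 < s * p) (hδ : 0 < δ) :
    ((∀ x : ℂ, x ∉ Set.range γ → windingNumber γ x = 0 ∨ windingNumber γ x = 1) →
      energyG s p δ γ < ⊤ → MemFracSobolev s p γ ∧ IsEmbeddedCurve γ) ∧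
    (∀ (t₁ t₂ : UnitAddCircle) (d₁ d₂ : ℂ), t₁ ≠ t₂ → γ t₁ = γ t₂ →
      HasCircleDerivAt γ d₁ t₁ → HasCircleDerivAt γ d₂ t₂ → d₁ ≠ d₂ →
      energyG s p δ γ = ⊤) := by
  obtain ⟨K₀, hK₀⟩ := hLip
  obtain ⟨C, hC, hspeed⟩ := hspeed
  -- Enlarged so that the Lipschitz constant is positive.
  set K : NNReal := K₀ + 1
  have hγ : LipschitzWith K γ := hK₀.weaken le_self_add
  have hK : 0 < K := by positivity
  refine ⟨fun hwind hfin => ?_, fun t₁ t₂ d₁ d₂ _ ht h₁ h₂ hne =>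
    energyG_eq_top_of_transversal hγ hK hC hspeed hp hsp hδ ht h₁ h₂ hne⟩
  have hE := tangentEnergy_ne_top_of_energyG_ne_top hδ hfin.ne
  obtain ⟨G, hG, hd⟩ := exists_continuous_hasDerivAt_of_tangentEnergy hγ hK hC hspeed hp hsp hE
  have hspeed' := norm_circleDeriv_eq (continuous_circleDeriv hG hd) hspeed
  have hGC : ∀ x, ‖G x‖ = C := fun x => by
    rw [← hspeed' (x : UnitAddCircle), circleDeriv_coe, (hd x).deriv]
  have hself : ∀ a b : ℝ, γ (a : UnitAddCircle) = γ (b : UnitAddCircle) → G a = G b :=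
    fun a b => deriv_eq_of_tangentEnergy hγ hK hC hspeed hp hsp hE hG hd
  have hinj := injective_of_windingNumber hG hd
    (fun x => norm_pos_iff.1 (by rw [hGC]; exact hC)) hself hwind
  obtain ⟨m, hm, hlow⟩ := exists_lower_lipschitz_bound hG
    (fun x => hself _ _ (periodic_lift γ x)) hd hC hGC hinj
  refine ⟨memFracSobolev_of_tangentEnergy hγ hK hC hspeed' hp hsp hE hG hd, ?_, ?_, hinj,
    m, K, hm, fun t t' => ⟨hlow t t', ?_⟩⟩
  · rw [CircleContDiff, contDiff_one_iff_deriv]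
    refine ⟨fun x => (hd x).differentiableAt, ?_⟩
    rwa [funext fun x => (hd x).deriv]
  · intro t
    exact norm_pos_iff.1 (by rw [hspeed']; exact hC)
  · simpa [dist_eq_norm] using hγ.dist_le_mul t t'
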